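/- Let $G$ be a finite simple graph with $n$ vertices. For $S\subseteq V(G)$ let $\partial S$ be the set of vertices outside $S$ that are adjacent to some vertex of $S$. Given $X\in\{0,1\}^{V(G)}$, a \emph{cluster} is a set $S\subseteq V(G)$ with $|S|\ge 2$ such that $G[S]$ is connected, $X_v=1$ for all $v\in S$ and $X_v=0$ for all $v\in\partial S$. For $\lambda>0$, the algorithm $\mathrm{PRSforIS}(G,\lambda)$ first samples the variables $X_v$ $(v\in V(G))$ independently from the Bernoulli distribution with parameter $\lambda/(1+\lambda)$; then, while $\{v:X_v=1\}$ is not an independent set of $G$, it chooses a cluster $S$ by a fixed valid rule (that is, deterministically and based only on the set of all current clusters) and resamples all variables $X_v$ with $v\in S\cup\partial S$, independently from the same distribution. Its runtime is the number of iterations of the loop. Lemma. There exist a function $\Delta\mapsto\lambda_\Delta$ from $\mathbb N$ to the positive reals with $\lambda_\Delta=\Theta(\Delta^{-1})$ as $\Delta\to\infty$, and an absolute constant $C$, such that for every graph $G$ with $n$ vertices and maximum degree $\Delta$, every $\lambda$ with $0<\lambda\le\lambda_\Delta$ and every valid rule, the expected runtime of $\mathrm{PRSforIS}(G,\lambda)$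 is at most $Cn$. -/

import Mathlib

open MeasureTheory ProbabilityTheory Filter Asymptotics
open scoped NNReal ENNReal

namespace PRSforIS

noncomputable section

open Classical in
/-- The boundary `∂S`: the vertices outside `S` that are adjacent to some vertex of `S`. -/
def boundary {V : Type*} [Fintype V] (G : SimpleGraph V) (S : Finset V) : Finset V :=
  Finset.univ.filter fun v => v ∉ S ∧ ∃ u ∈ S, G.Adj u v

open Classical in
/-- The scope `S ∪ ∂S` of the clause asserting that `S` is not a cluster. -/
def scope {V : Type*} [Fintype V] (G : SimpleGraph V) (S : Finset V) : Finset V :=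
  S ∪ boundary G S

/-- `S` is a cluster of the assignment `x`: it has at least two vertices, it induces a connected
subgraph, `x` is `1` on `S` and `x` is `0` on `∂S`. -/
def IsCluster {V : Type*} [Fintype V] (G : SimpleGraph V) (x : V → Bool) (S : Finset V) : Prop :=
  2 ≤ S.card ∧ (G.induce (S : Set V)).Connected ∧
    (∀ v ∈ S, x v = true) ∧ ∀ v ∈ boundary G S, x v = false

open Classical in
/-- The set of all clusters of `x`, that is, the set of all false clauses. -/
def clusters {V : Type*} [Fintype V] (G : SimpleGraph V) (x : V → Bool) : Finset (Finset V) :=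
  Finset.univ.filter fun S => IsCluster G x S

/-- The assignment `x` encodes an independent set. -/
def EncodesIndep {V : Type*} (G : SimpleGraph V) (x : V → Bool) : Prop :=
  G.IsIndepSet {v | x v = true}

/-- A valid rule chooses one of the current clusters, deterministically and based only on
the set of all current clusters. -/
def IsValidRule {V : Type*} (rule : Finset (Finset V) → Finset V) : Prop :=
  ∀ N : Finset (Finset V), N.Nonempty → rule N ∈ N

/-- A resampling table: the entry at `(v, j)` is the value that the variable `X_v` takes after it
has been resampled `j` times. -/
abbrev Table (V : Type*) : Type _ := V × ℕ → Bool

/-- The assignment that is read off the table `ω` at the frontier `j`. -/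
def readOff {V : Type*} (ω : Table V) (j : V → ℕ) : V → Bool :=
  fun v => ω (v, j v)

open Classical in
/-- The frontier after `t` iterations of the algorithm on the table `ω`. As long as the current
assignment does not encode an independent set, each iteration chooses a cluster `S` by the rule
and resamples the variables in `S ∪ ∂S`; afterwards nothing changes any more. -/
def frontier {V : Type*} [Fintype V] (G : SimpleGraph V) (rule : Finset (Finset V) → Finset V)
    (ω : Table V) : ℕ → V → ℕ
  | 0 => fun _ => 0
  | t + 1 =>
    let j := frontier G rule ω t
    let x := readOff ω j
    if EncodesIndep G x then j
    else fun v => if v ∈ scope G (rule (clusters G x)) then j v + 1 else j v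

/-- The assignment after `t` iterations. -/
def assignment {V : Type*} [Fintype V] (G : SimpleGraph V) (rule : Finset (Finset V) → Finset V)
    (ω : Table V) (t : ℕ) : V → Bool :=
  readOff ω (frontier G rule ω t)

/-- The running time on the table `ω`: the number of iterations of the loop before the assignment
encodes an independent set (`⊤` if that never happens). -/
def runtime {V : Type*} [Fintype V] (G : SimpleGraph V) (rule : Finset (Finset V) → Finset V)
    (ω : Table V) : ℕ∞ :=
  ⨅ (t : ℕ) (_ : EncodesIndep G (assignment G rule ω t)), (t : ℕ∞)

/-- The probability `lam / (1 + lam)` that a variable is `1`, at activity `lam`. -/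
def occProb (lam : ℝ≥0) : unitInterval :=
  ⟨(lam : ℝ) / (1 + lam), by positivity, by
    rw [div_le_one (by positivity)]
    linarith⟩

/-- The law of the resampling table at activity `lam`: its entries are independent and each is
Bernoulli with parameter `lam / (1 + lam)`. -/
def tableMeasure (V : Type*) (lam : ℝ≥0) : Measure (Table V) :=
  Measure.infinitePi fun _ : V × ℕ => bernoulliMeasure true false (occProb lam)

/-- The expected running time at activity `lam`, where the cluster to be resampled is chosen
by `rule`. -/
def expectedRuntime {V : Type*} [Fintype V] (G : SimpleGraph V) (lam : ℝ≥0)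
    (rule : Finset (Finset V) → Finset V) : ℝ≥0∞ :=
  ∫⁻ ω, (runtime G rule ω : ℝ≥0∞) ∂(tableMeasure V lam)

end

end PRSforIS

namespace PRSforIS

variable {V : Type*}

/-! The number of occupied vertices is a potential that drops by at least 1 in expectation at each
iteration. Resampling a cluster `S` erases its `|S|` ones, while the at most `|S| (Δ + 1)` variables
of its scope are redrawn, each being 1 with probability at most `lam ≤ 1 / (2 (Δ + 1))`. So at most
`|S| / 2` ones are expected back, and the loss is at least `|S| / 2 ≥ 1` (`resampled_add_one_le`).
The redrawn values are unbiased given the past because the state depends only on table entries up to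
the frontier (`measure_state_inter_entry`). As the potential starts at most `n` and is never
negative, the probabilities that the successive iterations take place sum to at most `n`. This sum
bounds the expected runtime, so `C = 1` works. -/

instance (lam : ℝ≥0) : IsProbabilityMeasure (tableMeasure V lam) := by
  unfold tableMeasure
  infer_instance

lemma tableMeasure_entry (lam : ℝ≥0) (e : V × ℕ) :
    tableMeasure V lam {ω | ω e = true} = ENNReal.ofReal (lam / (1 + lam)) := by
  have h := (measurePreserving_eval_infinitePi
    (fun _ : V × ℕ => bernoulliMeasure true false (occProb lam)) e).measure_preimage
    (MeasurableSet.singleton true).nullMeasurableSet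
  rw [bernoulliMeasure_apply_of_mem_of_notMem _ (MeasurableSet.singleton true) (Set.mem_singleton true) (by simp)] at h
  refine h.trans ?_
  rw [ENNReal.ofReal, ENNReal.coe_inj]
  ext
  rw [Real.coe_toNNReal _ (by positivity)]
  rfl

/-! ### Clusters and their scopes -/

variable [Fintype V]

/-- An assignment that does not encode an independent set has a cluster. -/
lemma exists_isCluster {G : SimpleGraph V} {x : V → Bool} (h : ¬ EncodesIndep G x) :
    ∃ S, IsCluster G x S := by
  classical
  obtain ⟨a, ha, b, hb, hab⟩ : ∃ a, x a = true ∧ ∃ b, x b = true ∧ G.Adj a b := by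
    by_contra! hc
    exact h fun a ha b hb _ => hc a ha b hb
  -- Unoccupied vertices are isolated in `H`, so the component of `a` is a maximal connected set of
  -- ones. Maximality forces zeros on its boundary.
  let H : SimpleGraph V :=
    { Adj := fun u v => G.Adj u v ∧ x u = true ∧ x v = true
      symm := ⟨fun u v huv => ⟨huv.1.symm, huv.2.2, huv.2.1⟩⟩
      loopless := ⟨fun u hu => G.loopless.irrefl u hu.1⟩ }
  let K := H.connectedComponentMk a
  have hmem (v : V) : v ∈ K.supp ↔ H.Reachable v a := by
    simp [K, SimpleGraph.ConnectedComponent.mem_supp_iff]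
  have hone (v : V) (hv : v ∈ K.supp) : x v = true := by
    obtain ⟨p⟩ := (hmem v).1 hv
    cases p with
    | nil => exact ha
    | cons hadj _ => exact hadj.2.1
  refine ⟨K.supp.toFinset, ?_, ?_, fun v hv => hone v (by simpa using hv), ?_⟩
  · refine Finset.one_lt_card.2 ⟨a, ?_, b, ?_, hab.ne⟩
    · rw [Set.mem_toFinset, hmem]
    · rw [Set.mem_toFinset, hmem]
      exact SimpleGraph.Adj.reachable (G := H) ⟨hab.symm, hb, ha⟩
  · rw [Set.coe_toFinset]
    exact K.connected_toSimpleGraph.mono fun u v (huv : H.Adj u v) => huv.1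
  · intro v hv
    simp only [boundary, Finset.mem_filter, Finset.mem_univ, true_and, Set.mem_toFinset] at hv
    obtain ⟨hvK, u, hu, huv⟩ := hv
    by_contra hxv
    rw [Bool.not_eq_false] at hxv
    refine hvK ((hmem v).2 (SimpleGraph.Reachable.trans ?_ ((hmem u).1 hu)))
    exact SimpleGraph.Adj.reachable (G := H) ⟨huv.symm, hxv, hone u hu⟩

lemma IsValidRule.isCluster {rule : Finset (Finset V) → Finset V} (hrule : IsValidRule rule)
    {G : SimpleGraph V} {x : V → Bool} (h : ¬ EncodesIndep G x) :
    IsCluster G x (rule (clusters G x)) := by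
  classical
  obtain ⟨S, hS⟩ := exists_isCluster h
  have := hrule (clusters G x) ⟨S, by simpa [clusters] using hS⟩
  simpa [clusters] using this

/-- The closed neighbourhoods of the vertices of `S` cover the scope. -/
lemma card_scope_le (G : SimpleGraph V) [DecidableRel G.Adj] (S : Finset V) :
    (scope G S).card ≤ S.card * (G.maxDegree + 1) := by
  classical
  calc (scope G S).card ≤ (S.biUnion fun v => insert v (G.neighborFinset v)).card := by
        refine Finset.card_le_card fun v hv => ?_
        simp only [scope, boundary, Finset.mem_union, Finset.mem_filter, Finset.mem_univ,
          true_and] at hv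
        simp only [Finset.mem_biUnion, Finset.mem_insert, SimpleGraph.mem_neighborFinset]
        rcases hv with hv | ⟨-, u, hu, huv⟩
        · exact ⟨v, hv, Or.inl rfl⟩
        · exact ⟨u, hu, Or.inr huv⟩
    _ ≤ S.card * (G.maxDegree + 1) := by
        refine Finset.card_biUnion_le_card_mul _ _ _ fun v _ => ?_
        refine (Finset.card_insert_le _ _).trans ?_
        rw [SimpleGraph.card_neighborFinset_eq_degree]
        exact Nat.succ_le_succ (G.degree_le_maxDegree v)

lemma subset_scope (G : SimpleGraph V) (S : Finset V) : S ⊆ scope G S := by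
  classical
  exact Finset.subset_union_left

/-! ### The run as a function of the table -/

section Run

variable (G : SimpleGraph V) (rule : Finset (Finset V) → Finset V)

lemma frontier_succ_of_encodesIndep {ω : Table V} {t : ℕ}
    (h : EncodesIndep G (assignment G rule ω t)) :
    frontier G rule ω (t + 1) = frontier G rule ω t := by
  rw [frontier]
  exact if_pos h

open Classical in
lemma frontier_succ_of_not_encodesIndep {ω : Table V} {t : ℕ}
    (h : ¬ EncodesIndep G (assignment G rule ω t)) :
    frontier G rule ω (t + 1) = fun v =>
      if v ∈ scope G (rule (clusters G (assignment G rule ω t))) then frontier G rule ω t v + 1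
      else frontier G rule ω t v := by
  rw [frontier]
  exact if_neg h

lemma frontier_le_succ (ω : Table V) (t : ℕ) (v : V) :
    frontier G rule ω t v ≤ frontier G rule ω (t + 1) v := by
  by_cases h : EncodesIndep G (assignment G rule ω t)
  · rw [frontier_succ_of_encodesIndep G rule h]
  · rw [frontier_succ_of_not_encodesIndep G rule h]
    dsimp only
    split_ifs <;> omega

/-- The state of the algorithm after `t` iterations: the frontier and the assignment. -/
noncomputable def state (ω : Table V) (t : ℕ) : (V → ℕ) × (V → Bool) :=
  (frontier G rule ω t, assignment G rule ω t)

/-- The state is determined by the part of the table up to the current frontier. -/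
lemma state_congr {ω ω' : Table V} {t : ℕ}
    (h : ∀ v, ∀ i ≤ frontier G rule ω t v, ω' (v, i) = ω (v, i)) :
    state G rule ω' t = state G rule ω t := by
  have hf : frontier G rule ω' t = frontier G rule ω t := by
    induction t with
    | zero => rfl
    | succ t ih =>
      have hle : ∀ v, ∀ i ≤ frontier G rule ω t v, ω' (v, i) = ω (v, i) :=
        fun v i hi => h v i (hi.trans (frontier_le_succ G rule ω t v))
      have hr : readOff ω' (frontier G rule ω t) = readOff ω (frontier G rule ω t) :=
        funext fun v => hle v _ le_rfl
      rw [frontier, frontier, ih hle, hr]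
  refine Prod.ext hf (funext fun v => ?_)
  simp only [state, assignment, readOff, hf]
  exact h v _ le_rfl

lemma measurable_state (t : ℕ) : Measurable fun ω : Table V => state G rule ω t := by
  have hr (J : Table V → V → ℕ) (hJ : Measurable J) :
      Measurable fun ω => readOff ω (J ω) := by
    refine measurable_pi_lambda _ fun v => ?_
    -- The index read off is itself random, but ranges over a countable set.
    have h1 : Measurable fun q : Table V × ℕ => q.1 (v, q.2) :=
      measurable_from_prod_countable_left fun i => measurable_pi_apply (v, i)
    exact h1.comp (measurable_id.prodMk ((measurable_pi_apply v).comp hJ))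
  have hf : Measurable fun ω : Table V => frontier G rule ω t := by
    induction t with
    | zero => exact measurable_const
    | succ t ih =>
      classical
      let step : (V → ℕ) × (V → Bool) → V → ℕ := fun b =>
        if EncodesIndep G b.2 then b.1
        else fun v => if v ∈ scope G (rule (clusters G b.2)) then b.1 v + 1 else b.1 v
      have h2 : Measurable step := measurable_of_countable _
      convert h2.comp (ih.prodMk (hr _ ih)) using 1
      funext ω
      rw [frontier]
      simp only [step, Function.comp]
  exact hf.prodMk (hr _ hf)

/-- The entry next to the frontier is independent of the current state. -/
lemma measure_state_inter_entry (lam : ℝ≥0) (t : ℕ) (j : V → ℕ) (x : V → Bool) (v : V) :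
    tableMeasure V lam ({ω | state G rule ω t = (j, x)} ∩ {ω | ω (v, j v + 1) = true}) =
      tableMeasure V lam {ω | state G rule ω t = (j, x)} *
        ENNReal.ofReal (lam / (1 + lam)) := by
  classical
  -- The entries revealed so far when the frontier is `j`. The fresh entry in `T` lies just beyond
  -- them.
  let A : Finset (V × ℕ) := Finset.univ.biUnion fun u => (Finset.range (j u + 1)).map
    ⟨fun i => (u, i), fun _ _ h => (Prod.mk.inj h).2⟩
  have hA (u : V) (i : ℕ) : (u, i) ∈ A ↔ i ≤ j u := by
    simp only [A, Finset.mem_biUnion, Finset.mem_map, Finset.mem_range, Finset.mem_univ, true_and]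
    exact ⟨fun ⟨_, _, hi, h⟩ => by cases h; omega, fun h => ⟨u, i, by omega, rfl⟩⟩
  let T : Finset (V × ℕ) := {(v, j v + 1)}
  have hAT : Disjoint A T := by
    rw [Finset.disjoint_singleton_right, hA]
    omega
  have hind : iIndepFun (fun (e : V × ℕ) (ω : Table V) => ω e) (tableMeasure V lam) :=
    iIndepFun_infinitePi (P := fun _ : V × ℕ => bernoulliMeasure true false (occProb lam))
      (X := fun _ b => b) fun _ => measurable_id
  have hAT' := hind.indepFun_finset A T hAT fun e => measurable_pi_apply e
  -- The filler `false` is harmless: by `state_congr`, entries beyond the frontier do not affect the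
  -- state, so the event is determined by the entries in `A`.
  let extend : (A → Bool) → Table V := fun y e => if he : e ∈ A then y ⟨e, he⟩ else false
  have hB : {ω | state G rule ω t = (j, x)} =
      (fun (ω : Table V) (e : A) => ω e) ⁻¹' {y | state G rule (extend y) t = (j, x)} := by
    ext ω
    have hext (u : V) (i : ℕ) (hi : i ≤ j u) :
        extend (fun e : A => ω e) (u, i) = ω (u, i) := by
      simp [extend, (hA u i).2 hi]
    constructor
    · intro h
      have hj : frontier G rule ω t = j := congrArg Prod.fst h
      refine (state_congr G rule fun u i hi => hext u i ?_).trans h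
      rwa [hj] at hi
    · intro h
      have hj : frontier G rule (extend fun e : A => ω e) t = j := congrArg Prod.fst h
      refine (state_congr G rule fun u i hi => (hext u i ?_).symm).trans h
      rwa [hj] at hi
  have hE : {ω : Table V | ω (v, j v + 1) = true} =
      (fun (ω : Table V) (e : T) => ω e) ⁻¹'
        {y | y ⟨(v, j v + 1), Finset.mem_singleton_self _⟩ = true} := rfl
  have := hAT'.measure_inter_preimage_eq_mul _ _
    (Set.toFinite {y | state G rule (extend y) t = (j, x)}).measurableSet
    (Set.toFinite
      {y : T → Bool | y ⟨(v, j v + 1), Finset.mem_singleton_self _⟩ = true}).measurableSet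
  rw [← hB, ← hE, tableMeasure_entry] at this
  exact this

/-! ### Expected decrease of the potential -/

/-- The number of occupied vertices. -/
noncomputable def occupied (x : V → Bool) : ℝ≥0∞ := ∑ v, if x v = true then 1 else 0

lemma occupied_le (x : V → Bool) : occupied x ≤ Fintype.card V := by
  refine (Finset.sum_le_card_nsmul _ _ 1 fun v _ => ?_).trans (by simp)
  split_ifs <;> simp

/-- Once the state is fixed, so is the resampled scope. Values outside it persist, and those inside
are the fresh entries `(v, j v + 1)`, independent of the state. -/
lemma setLIntegral_occupied_succ {lam : ℝ≥0} {t : ℕ} {j : V → ℕ} {x : V → Bool}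
    (hx : ¬ EncodesIndep G x) :
    ∫⁻ ω in {ω | state G rule ω t = (j, x)}, occupied (assignment G rule ω (t + 1))
        ∂tableMeasure V lam =
      tableMeasure V lam {ω | state G rule ω t = (j, x)} *
        ((open Classical in ∑ v ∈ (scope G (rule (clusters G x)))ᶜ, if x v = true then 1 else 0) +
          (scope G (rule (clusters G x))).card * ENNReal.ofReal (lam / (1 + lam))) := by
  classical
  set B := {ω : Table V | state G rule ω t = (j, x)} with hBdef
  set R := scope G (rule (clusters G x)) with hR
  have hBm : MeasurableSet B := measurable_state G rule t (MeasurableSet.singleton (j, x))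
  have hval : ∀ ω ∈ B, occupied (assignment G rule ω (t + 1)) =
      (∑ v ∈ Rᶜ, if x v = true then 1 else 0) +
        ∑ v ∈ R, {ω : Table V | ω (v, j v + 1) = true}.indicator 1 ω := by
    intro ω hω
    have hj : frontier G rule ω t = j := congrArg Prod.fst hω
    have hxω : assignment G rule ω t = x := congrArg Prod.snd hω
    have hnext := frontier_succ_of_not_encodesIndep G rule (ω := ω) (t := t) (by rwa [hxω])
    rw [hxω, hj, ← hR] at hnext
    rw [occupied, ← Finset.sum_compl_add_sum R]
    congr 1
    · refine Finset.sum_congr rfl fun v hv => ?_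
      rw [Finset.mem_compl] at hv
      have : assignment G rule ω (t + 1) v = x v := by
        rw [← hxω]
        simp [assignment, readOff, hnext, hv, hj]
      rw [this]
    · refine Finset.sum_congr rfl fun v hv => ?_
      simp [assignment, readOff, hnext, hv, Set.indicator_apply]
  have hEm (v : V) : MeasurableSet {ω : Table V | ω (v, j v + 1) = true} :=
    measurableSet_eq_fun (measurable_pi_apply (v, j v + 1)) measurable_const
  rw [setLIntegral_congr_fun hBm hval, lintegral_add_left measurable_const,
    lintegral_finsetSum _ fun v _ => measurable_one.indicator (hEm v), setLIntegral_const]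
  have hE (v : V) : ∫⁻ ω in B, {ω : Table V | ω (v, j v + 1) = true}.indicator 1 ω
      ∂tableMeasure V lam = tableMeasure V lam B * ENNReal.ofReal (lam / (1 + lam)) := by
    rw [lintegral_indicator_one (hEm v), Measure.restrict_apply (hEm v), Set.inter_comm,
      measure_state_inter_entry]
  simp only [hE]
  rw [Finset.sum_const, nsmul_eq_mul, mul_add, mul_left_comm, mul_comm _ (tableMeasure V lam B)]

/-- Resampling a cluster decreases the expected number of occupied vertices by at least `1`. -/
lemma resampled_add_one_le [DecidableRel G.Adj] {lam : ℝ≥0}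
    (hlam : (lam : ℝ) ≤ (2 * ((G.maxDegree : ℝ) + 1))⁻¹) {x : V → Bool} {S : Finset V}
    (hS : IsCluster G x S) :
    (open Classical in ∑ v ∈ (scope G S)ᶜ, if x v = true then 1 else 0) +
      (scope G S).card * ENNReal.ofReal (lam / (1 + lam)) + 1 ≤ occupied x := by
  classical
  -- The expected number of new ones is at most `|S| / 2`, and `|S| ≥ 2` leaves room for the extra
  -- 1.
  have hcard : (scope G S).card * ((lam : ℝ) / (1 + lam)) + 1 ≤ S.card := by
    have h1 : ((scope G S).card : ℝ) ≤ S.card * (G.maxDegree + 1) := by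
      exact_mod_cast card_scope_le G S
    have h2 : (2 : ℝ) ≤ S.card := by exact_mod_cast hS.1
    have h3 : (lam : ℝ) / (1 + lam) ≤ (2 * ((G.maxDegree : ℝ) + 1))⁻¹ :=
      (div_le_self lam.2 (by simp)).trans hlam
    have h4 : (scope G S).card * ((lam : ℝ) / (1 + lam)) ≤
        S.card * (G.maxDegree + 1) * (2 * ((G.maxDegree : ℝ) + 1))⁻¹ := by gcongr
    have h5 : S.card * (G.maxDegree + 1) * (2 * ((G.maxDegree : ℝ) + 1))⁻¹ = (S.card : ℝ) / 2 := by
      field_simp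
    linarith
  have hcard' : (scope G S).card * ENNReal.ofReal (lam / (1 + lam)) + 1 ≤ (S.card : ℝ≥0∞) := by
    have := ENNReal.ofReal_le_ofReal hcard
    rwa [ENNReal.ofReal_add (by positivity) zero_le_one, ENNReal.ofReal_mul (by positivity),
      ENNReal.ofReal_natCast, ENNReal.ofReal_one, ENNReal.ofReal_natCast] at this
  rw [occupied, ← Finset.sum_compl_add_sum (scope G S), add_assoc]
  gcongr
  refine hcard'.trans ?_
  calc (S.card : ℝ≥0∞) = ∑ v ∈ S, if x v = true then 1 else 0 := by
        rw [Finset.sum_congr rfl fun v hv => if_pos (hS.2.2.1 v hv)]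
        simp
    _ ≤ _ := Finset.sum_le_sum_of_subset (subset_scope G S)

variable {rule}

lemma measurableSet_not_encodesIndep (t : ℕ) :
    MeasurableSet {ω : Table V | ¬ EncodesIndep G (assignment G rule ω t)} :=
  (measurable_state G rule t).snd (Set.toFinite {x | ¬ EncodesIndep G x}).measurableSet

/-- Each iteration decreases the expected number of occupied vertices by at least the probability
that the iteration takes place. -/
lemma lintegral_occupied_succ_add_le [DecidableRel G.Adj] (hrule : IsValidRule rule) {lam : ℝ≥0}
    (hlam : (lam : ℝ) ≤ (2 * ((G.maxDegree : ℝ) + 1))⁻¹) (t : ℕ) :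
    ∫⁻ ω, occupied (assignment G rule ω (t + 1)) ∂tableMeasure V lam +
        tableMeasure V lam {ω | ¬ EncodesIndep G (assignment G rule ω t)} ≤
      ∫⁻ ω, occupied (assignment G rule ω t) ∂tableMeasure V lam := by
  classical
  -- There are countably many states, so conditioning on the state is a sum over these events.
  let B : (V → ℕ) × (V → Bool) → Set (Table V) := fun b => {ω | state G rule ω t = b}
  have hBm (b) : MeasurableSet (B b) := measurable_state G rule t (MeasurableSet.singleton b)
  have hdisj : Pairwise (Function.onFun Disjoint B) := fun b b' hbb' =>
    Set.disjoint_left.2 fun ω h h' => hbb' (h.symm.trans h')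
  have hunion : ⋃ b, B b = Set.univ := Set.eq_univ_of_forall fun ω =>
    Set.mem_iUnion.2 ⟨state G rule ω t, rfl⟩
  have hsplit (f : Table V → ℝ≥0∞) : ∫⁻ ω, f ω ∂tableMeasure V lam =
      ∑' b, ∫⁻ ω in B b, f ω ∂tableMeasure V lam := by
    rw [← lintegral_iUnion hBm hdisj, hunion, Measure.restrict_univ]
  rw [← lintegral_indicator_one (measurableSet_not_encodesIndep G t), hsplit, hsplit,
    hsplit (fun ω => occupied (assignment G rule ω t)), ← ENNReal.tsum_add]
  refine ENNReal.tsum_le_tsum fun ⟨j, x⟩ => ?_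
  have hx {ω} (hω : ω ∈ B (j, x)) : assignment G rule ω t = x := congrArg Prod.snd hω
  by_cases hind : EncodesIndep G x
  · rw [setLIntegral_congr_fun (f := Set.indicator _ _) (g := 0) (hBm _) fun ω hω => ?_]
    · simp only [Pi.zero_apply, lintegral_zero, add_zero]
      refine (setLIntegral_congr_fun (hBm _) fun ω hω => ?_).le
      simp only [assignment]
      rw [frontier_succ_of_encodesIndep]
      rwa [hx hω]
    · simp [hx hω, hind]
  · have h1 : ∫⁻ ω in B (j, x), {ω | ¬ EncodesIndep G (assignment G rule ω t)}.indicator 1 ω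
        ∂tableMeasure V lam = tableMeasure V lam (B (j, x)) := by
      rw [setLIntegral_congr_fun (g := 1) (hBm _) fun ω hω => ?_]
      · simp
      · simp [hx hω, hind]
    have h2 : ∫⁻ ω in B (j, x), occupied (assignment G rule ω t) ∂tableMeasure V lam =
        tableMeasure V lam (B (j, x)) * occupied x := by
      rw [setLIntegral_congr_fun (g := fun _ => occupied x) (hBm _) fun ω hω => ?_]
      · rw [setLIntegral_const, mul_comm]
      · simp only [hx hω]
    have h3 := mul_le_mul_right (resampled_add_one_le G hlam (hrule.isCluster hind))
      (tableMeasure V lam (B (j, x)))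
    rw [h1, h2, setLIntegral_occupied_succ G rule hind]
    rwa [mul_add, mul_one] at h3

/-! ### From the potential to the runtime -/

/-- The running time is at most the number of times at which the assignment does not encode an
independent set. -/
lemma runtime_le_tsum (ω : Table V) :
    (runtime G rule ω : ℝ≥0∞) ≤
      ∑' t, {ω | ¬ EncodesIndep G (assignment G rule ω t)}.indicator 1 ω := by
  classical
  have hsum (n : ℕ) (h : ∀ t < n, ¬ EncodesIndep G (assignment G rule ω t)) : (n : ℝ≥0∞) ≤
      ∑' t, {ω | ¬ EncodesIndep G (assignment G rule ω t)}.indicator 1 ω := by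
    refine le_trans ?_ (ENNReal.sum_le_tsum (Finset.range n))
    rw [Finset.sum_congr rfl fun t ht => Set.indicator_of_mem (h t (Finset.mem_range.1 ht)) _]
    simp
  by_cases hex : ∃ t, EncodesIndep G (assignment G rule ω t)
  · refine le_trans ?_ (hsum (Nat.find hex) fun t ht => Nat.find_min hex ht)
    have : runtime G rule ω ≤ (Nat.find hex : ℕ∞) :=
      iInf₂_le (f := fun (t : ℕ) (_ : EncodesIndep G (assignment G rule ω t)) => (t : ℕ∞)) _
        (Nat.find_spec hex)
    exact_mod_cast ENat.toENNReal_le.2 this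
  · push Not at hex
    -- If the run never stops, every term is 1 and the sum is infinite.
    refine le_top.trans_eq (ENNReal.eq_top_of_forall_nnreal_le fun r => ?_).symm
    obtain ⟨n, hn⟩ := exists_nat_ge r
    exact le_trans (by exact_mod_cast hn) (hsum n fun t _ => hex t)

theorem expectedRuntime_le_card [DecidableRel G.Adj] (hrule : IsValidRule rule) {lam : ℝ≥0}
    (hlam : (lam : ℝ) ≤ (2 * ((G.maxDegree : ℝ) + 1))⁻¹) :
    expectedRuntime G lam rule ≤ Fintype.card V := by
  -- The remaining potential stays on the left, so the decreases telescope without subtraction in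
  -- `ℝ≥0∞`.
  have hpartial (n : ℕ) :
      ∫⁻ ω, occupied (assignment G rule ω n) ∂tableMeasure V lam + ∑ t ∈ Finset.range n,
        tableMeasure V lam {ω | ¬ EncodesIndep G (assignment G rule ω t)} ≤ Fintype.card V := by
    induction n with
    | zero =>
      rw [Finset.sum_range_zero, add_zero]
      refine (lintegral_mono fun ω => occupied_le _).trans ?_
      simp
    | succ n ih =>
      refine le_trans ?_ ih
      rw [Finset.sum_range_succ, add_comm (∑ t ∈ _, _), ← add_assoc]
      gcongr
      exact lintegral_occupied_succ_add_le G hrule hlam n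
  calc expectedRuntime G lam rule
      ≤ ∫⁻ ω, ∑' t, {ω | ¬ EncodesIndep G (assignment G rule ω t)}.indicator 1 ω
          ∂tableMeasure V lam := lintegral_mono fun ω => runtime_le_tsum G ω
    _ = ∑' t, tableMeasure V lam {ω | ¬ EncodesIndep G (assignment G rule ω t)} := by
        rw [lintegral_tsum fun t =>
          (measurable_one.indicator (measurableSet_not_encodesIndep G t)).aemeasurable]
        exact tsum_congr fun t => lintegral_indicator_one (measurableSet_not_encodesIndep G t)
    _ ≤ Fintype.card V := ENNReal.tsum_le_of_sum_range_le fun n =>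
        le_add_self.trans (hpartial n)

end Run

lemma isTheta_inv_two_mul_add_one :
    (fun Δ : ℕ => (2 * ((Δ : ℝ) + 1))⁻¹) =Θ[atTop] fun Δ : ℕ => (Δ : ℝ)⁻¹ := by
  -- For `Δ ≥ 1`, `2 (Δ + 1) ≤ 4 Δ` and `Δ ≤ 2 (Δ + 1)`.
  refine Asymptotics.IsTheta.inv ⟨.of_bound 4 ?_, .of_bound 1 ?_⟩ <;>
    filter_upwards [eventually_ge_atTop 1] with Δ hΔ <;>
    · have : (1 : ℝ) ≤ Δ := by exact_mod_cast hΔ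
      rw [Real.norm_of_nonneg (by positivity), Real.norm_of_nonneg (by positivity)]
      linarith

end PRSforIS

theorem mainTheorem7 :
    ∃ lamMax : ℕ → ℝ, (∀ Δ : ℕ, 0 < lamMax Δ) ∧
      (lamMax =Θ[atTop] fun Δ : ℕ => (Δ : ℝ)⁻¹) ∧
      ∃ C : ℝ≥0, ∀ (n Δ : ℕ) (G : SimpleGraph (Fin n)) [DecidableRel G.Adj],
        G.maxDegree = Δ →
        ∀ lam : ℝ≥0, 0 < lam → (lam : ℝ) ≤ lamMax Δ →
        ∀ rule : Finset (Finset (Fin n)) → Finset (Fin n), PRSforIS.IsValidRule rule →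
          PRSforIS.expectedRuntime G lam rule ≤ (C : ℝ≥0∞) * (n : ℝ≥0∞) := by
  refine ⟨fun Δ => (2 * ((Δ : ℝ) + 1))⁻¹, fun Δ => by positivity,
    PRSforIS.isTheta_inv_two_mul_add_one, 1, ?_⟩
  rintro n _ G _ rfl lam - hlam rule hrule
  simpa using PRSforIS.expectedRuntime_le_card G hrule hlam
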